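/- Let $A\in\mathbb{R}^{n\times m}$ be a nonzero matrix, let $0<\epsilon<1$, and let $W\in\mathbb{R}^{m\times m}$ be a diagonal matrix all of whose diagonal entries are nonzero. Let $\sigma_i(A)$ denote the singular values of $A$, and set $$\mathrm{srank}_4(A):=\frac{\big(\sum_i\sigma_i(A)^2\big)^2}{\sum_i\sigma_i(A)^4}.$$ Then there exists a subset $S\subseteq\{1,\dots,m\}$ of size $$|S|=\big\lfloor(1-\epsilon)^2\,\mathrm{srank}_4(A)\big\rfloor+1$$ such that $$\sigma_{\min}(A_SW_S)\ \ge\ \epsilon\,\frac{\|A\|_F}{\|W^{-1}\|_F}.$$ Here $A_S\in\mathbb{R}^{n\times|S|}$ is the submatrix of $A$ formed by the columns indexed by $S$, $W_S\in\mathbb{R}^{|S|\times|S|}$ is the submatrix of $W$ formed by the rows and columns indexed by $S$, $\sigma_{\min}(B):=\min_{\|x\|_2=1}\|Bx\|_2$, and $\|\cdot\|_F$ is the Frobenius norm. -/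

import Mathlib

open scoped Matrix.Norms.Frobenius

/-- The least singular value `min_{‖x‖₂ = 1} ‖B x‖₂` of a real matrix, with Euclidean norms on both
sides. (For at least one column the unit sphere is compact and nonempty, so the infimum is
attained.) -/
noncomputable def sigmaMin {ι κ : Type*} [Fintype ι] [Fintype κ] [DecidableEq κ]
    (B : Matrix ι κ ℝ) : ℝ :=
  sInf ((fun x : EuclideanSpace ℝ κ => ‖Matrix.toEuclideanLin B x‖) '' Metric.sphere 0 1)

/-- The Schatten `4`-norm stable rank `(∑ σᵢ²)² / ∑ σᵢ⁴`, where the sums run over the nonzero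
singular values of `A`, listed with multiplicity. -/
noncomputable def srank4 {n m : ℕ} (A : Matrix (Fin n) (Fin m) ℝ) : ℝ :=
  ((Matrix.toEuclideanLin A).singularValues.sum fun _ s => s ^ 2) ^ 2 /
    (Matrix.toEuclideanLin A).singularValues.sum fun _ s => s ^ 4

/-- The submatrix `A_S` of the columns of `A` indexed by `S`. -/
def colSubmatrix {n m : ℕ} (A : Matrix (Fin n) (Fin m) ℝ) (S : Finset (Fin m)) :
    Matrix (Fin n) S ℝ :=
  A.submatrix id Subtype.val

/-- The principal submatrix `W_S` of `W` with rows and columns indexed by `S`. -/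
def principalSubmatrix {m : ℕ} (W : Matrix (Fin m) (Fin m) ℝ) (S : Finset (Fin m)) :
    Matrix S S ℝ :=
  W.submatrix Subtype.val Subtype.val

/-!
The proof is by interlacing polynomials. Put `σ = ‖W⁻¹‖_F`, and sample `k + 1` of the vectors
`σ wᵢ aᵢ` independently, the `i`-th with probability `wᵢ⁻² / σ²`, so that a sample `v` satisfies
`E[v vᵀ] = A Aᵀ`. The expected characteristic polynomial of the Gram matrix of the samples is
`∏ₐ (1 - σₐ² D) x ^ (k + 1)`, where `σₐ` are the singular values of `A` and `D = d/dx`. Each factor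
`1 - λ D` raises the lower barrier function's base point by a controlled amount, which for
`k ≤ (1 - ε)² srank₄ A` keeps all roots above `ε² ‖A‖_F²`.

To pass from the average to one choice of samples, fix them one at a time. The average after fixing
one more sample, divided by the current average, maps the upper half plane to itself and is negative
on the negative half line. Hence it increases up to the least root of the current average, and some
choice of the next sample does not lower the least root. Since the final least root is positive,
the chosen vectors are linearly independent, in particular distinct.
-/

open Polynomial Matrix

section Determinant

theorem map_add_smul_eq_add_linearDeriv {ι R M N : Type*} [Fintype ι] [DecidableEq ι] [CommRing R]
    [AddCommGroup M] [Module R M] [AddCommGroup N] [Module R N] (f : M [⋀^ι]→ₗ[R] N) (a : ι → M)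
    (c : ι → R) (v : M) :
    f (a + fun i => c i • v) = f a + f.toMultilinearMap.linearDeriv a fun i => c i • v := by
  refine (f.toMultilinearMap.map_add_eq_map_add_linearDeriv_add a _).trans
    (add_eq_left.2 (Finset.sum_eq_zero fun s hs => ?_))
  -- Every term of order at least two has two arguments proportional to `v`.
  obtain ⟨i, hi, j, hj, hij⟩ := Finset.one_lt_card.1 (Finset.mem_filter.1 hs).2
  have factor : s.piecewise (fun i => c i • v) a =
      fun i => s.piecewise c 1 i • s.piecewise (fun _ => v) a i := by
    funext i
    by_cases hi : i ∈ s <;> simp [hi]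
  rw [factor, MultilinearMap.map_smul_univ]
  exact smul_eq_zero_of_right _ (f.map_eq_zero_of_eq _ (by simp [hi, hj]) hij)

variable {n R : Type*} [Fintype n] [DecidableEq n] [CommRing R]

/-- The differential of the determinant at `A`, as a linear form in the direction `B`. -/
noncomputable def detDeriv (A : Matrix n n R) : Matrix n n R →ₗ[R] R :=
  (detRowAlternating (n := n) (R := R)).toMultilinearMap.linearDeriv A

theorem detDeriv_apply (A B : Matrix n n R) :
    detDeriv A B = ∑ i, (A.updateRow i (B i)).det :=
  MultilinearMap.linearDeriv_apply _ _ _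

theorem det_add_smul_vecMulVec (A : Matrix n n R) (c : R) (u v : n → R) :
    (A + c • vecMulVec u v).det = A.det + c * detDeriv A (vecMulVec u v) := by
  rw [← smul_eq_mul, ← map_smul, ← smul_vecMulVec]
  exact map_add_smul_eq_add_linearDeriv detRowAlternating A (c • u) v

theorem derivative_det (N : Matrix n n R[X]) :
    derivative N.det = detDeriv N (N.map derivative) := by
  simp only [detDeriv_apply, ← det_transpose N, ← det_transpose (updateRow _ _ _), det_apply',
    transpose_apply, derivative_sum]
  rw [Finset.sum_comm]
  refine Finset.sum_congr rfl fun σ _ => ?_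
  rw [derivative_mul, derivative_intCast, zero_mul, zero_add, derivative_prod_finset,
    Finset.mul_sum]
  refine Finset.sum_congr rfl fun i _ => ?_
  rw [← Finset.prod_erase_mul (f := fun j => N.updateRow i _ j _) _ (Finset.mem_univ i),
    updateRow_self, map_apply]
  congr 2
  exact Finset.prod_congr rfl fun j hj => by rw [updateRow_ne (Finset.ne_of_mem_erase hj)]

end Determinant

section DifferentialOperator

variable {R : Type*} [CommRing R]

/-- The commutation relation `[g(D), X] = g'(D)`. -/
theorem aeval_derivative_X_mul (g h : R[X]) :
    aeval (derivative : Module.End R R[X]) g (X * h) =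
      X * aeval (derivative : Module.End R R[X]) g h +
        aeval (derivative : Module.End R R[X]) (derivative g) h := by
  induction g using Polynomial.induction_on' with
  | add g₁ g₂ h₁ h₂ => simp only [map_add, LinearMap.add_apply, h₁, h₂]; ring
  | monomial m a =>
    simp only [derivative_monomial, aeval_monomial, Module.End.mul_apply,
      Module.algebraMap_end_apply, Module.End.coe_pow, mul_comm X, iterate_derivative_mul_X,
      smul_add, smul_mul_assoc, mul_smul, Nat.cast_smul_eq_nsmul]

theorem eval_aeval_derivative_X_pow (x : R) (k : ℕ) (g : R[X]) :
    (aeval (derivative : Module.End R R[X]) g (X ^ k)).eval x =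
      (((algebraMap R (Module.End R R[X]) x + derivative) ^ k : Module.End R R[X]) g).eval 0 := by
  induction k generalizing g with
  | zero =>
    nth_rewrite 1 [← divX_mul_X_add g]
    simp [← coeff_zero_eq_eval_zero, Module.End.mul_apply]
  | succ k ih =>
    rw [pow_succ', aeval_derivative_X_mul, pow_succ _ k, Module.End.mul_apply, ← ih]
    simp [Module.algebraMap_end_apply]

end DifferentialOperator

section Average

variable {ι n k : Type*} [Fintype n] [DecidableEq n] [Field k]

/-- The matrix `u uᵀ` of a vector `u` over `k`, with entries in the extension `K`. -/
def rankOne (K : Type*) [CommRing K] [Algebra k K] (u : n → k) : Matrix n n K :=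
  vecMulVec (algebraMap k K ∘ u) (algebraMap k K ∘ u)

/-- The matrix whose rows are the vectors `v i` for `i` in the list `L`. -/
def rowsOfList (v : ι → n → k) (L : List ι) : Matrix (Fin L.length) n k :=
  of fun s => v (L.get s)

omit [Fintype n] [DecidableEq n] in
theorem transpose_mul_rowsOfList (v : ι → n → k) (L : List ι) :
    (rowsOfList v L)ᵀ * rowsOfList v L = (L.map fun i => vecMulVec (v i) (v i)).sum := by
  ext a b
  rw [mul_apply]
  simp only [transpose_apply, rowsOfList, of_apply]
  refine (Fin.sum_univ_fun_getElem L fun i => v i a * v i b).trans ?_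
  induction L with
  | nil => simp
  | cons i L ih => simp [ih, vecMulVec_apply]

variable [Fintype ι] {K : Type*} [Field K] [Algebra k K]

/-- The average of `x ^ j * det (B - x⁻¹ ∑ₛ vₛ vₛᵀ)` over `j` independent samples `vₛ` taken from
`v` with weights `p`. -/
def detAverage (p : ι → k) (v : ι → n → k) (x : K) : ℕ → Matrix n n K → K
  | 0, B => B.det
  | j + 1, B => ∑ i, p i • (x * detAverage p v x j (B - x⁻¹ • rankOne K (v i)))

/-- The average of the characteristic polynomials of the Gram matrices of the vectors listed by `L`
together with `j` further independent samples from `v` with weights `p`. -/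
noncomputable def gramAverage (p : ι → k) (v : ι → n → k) : ℕ → List ι → k[X]
  | 0, L => (rowsOfList v L * (rowsOfList v L)ᵀ).charpoly
  | j + 1, L => ∑ i, p i • gramAverage p v j (i :: L)

theorem eval_charpoly_mul_comm {m : Type*} [Fintype m] [DecidableEq m] (A : Matrix m n K)
    (B : Matrix n m K) {x : K} (hx : x ≠ 0) :
    (A * B).charpoly.eval x = x ^ Fintype.card m * (1 - x⁻¹ • (B * A)).det := by
  have factor : Matrix.scalar m x - A * B = x • (1 - (x⁻¹ • A) * B) := by
    rw [smul_sub, smul_mul, smul_smul, mul_inv_cancel₀ hx, one_smul, smul_one_eq_diagonal,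
      scalar_apply]
  rw [eval_charpoly, factor, det_smul, det_one_sub_mul_comm, Matrix.mul_smul]

theorem aeval_gramAverage (p : ι → k) (v : ι → n → k) {x : K} (hx : x ≠ 0) (j : ℕ) (L : List ι) :
    aeval x (gramAverage p v j L) = x ^ L.length *
      detAverage p v x j (1 - x⁻¹ • (L.map fun i => rankOne K (v i)).sum) := by
  induction j generalizing L with
  | zero =>
    have base_change : (rowsOfList v L * (rowsOfList v L)ᵀ).map (algebraMap k K) =
        rowsOfList (fun i => algebraMap k K ∘ v i) L *
          (rowsOfList (fun i => algebraMap k K ∘ v i) L)ᵀ := Matrix.map_mul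
    rw [gramAverage, detAverage, ← eval_map_algebraMap, ← charpoly_map, base_change,
      eval_charpoly_mul_comm _ _ hx, transpose_mul_rowsOfList, Fintype.card_fin]
    rfl
  | succ j ih =>
    simp only [gramAverage, detAverage, map_sum, map_smul, ih, List.length_cons, List.map_cons,
      List.sum_cons, Finset.mul_sum, smul_add, ← sub_sub, sub_right_comm _ (x⁻¹ • rankOne K _),
      mul_smul_comm, pow_succ, mul_assoc]

theorem exists_detAverage_add_smul (p : ι → k) (v : ι → n → k) (x : K) (j : ℕ) (B : Matrix n n K)
    (u w : n → K) :
    ∃ κ, ∀ t, detAverage p v x j (B + t • vecMulVec u w) = detAverage p v x j B + t * κ := by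
  induction j generalizing B with
  | zero => exact ⟨detDeriv B (vecMulVec u w), fun t => det_add_smul_vecMulVec B t u w⟩
  | succ j ih =>
    choose κ hκ using fun i => ih (B - x⁻¹ • rankOne K (v i))
    refine ⟨∑ i, p i • (x * κ i), fun t => ?_⟩
    simp only [detAverage, add_sub_right_comm, hκ, mul_add, smul_add, Finset.sum_add_distrib,
      Finset.mul_sum, mul_left_comm t, mul_smul_comm]

end Average

section ExpectedCharpoly

variable {ι n k : Type*} [Fintype ι] [Fintype n] [DecidableEq n] [Field k]

theorem sum_smul_det_sub_rankOne {p : ι → k} (hp : ∑ i, p i = 1) (v : ι → n → k) {x : k}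
    (hx : x ≠ 0) {N : Matrix n n k[X]}
    (hN : N.map derivative = -∑ i, p i • rankOne k[X] (v i)) :
    ∑ i, (p i * x) • (N - x⁻¹ • rankOne k[X] (v i)).det = x • N.det + derivative N.det := by
  have perturb (i : ι) : (N - x⁻¹ • rankOne k[X] (v i)).det =
      N.det - x⁻¹ • detDeriv N (rankOne k[X] (v i)) := by
    rw [sub_eq_add_neg, ← neg_smul, ← algebraMap_smul k[X] (-x⁻¹), rankOne,
      det_add_smul_vecMulVec, map_neg, neg_mul, ← sub_eq_add_neg, ← Algebra.smul_def]
  simp only [perturb, smul_sub, Finset.sum_sub_distrib, ← Finset.sum_smul, ← Finset.sum_mul, hp,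
    one_mul, smul_smul, mul_assoc, mul_inv_cancel₀ hx, mul_one]
  simp only [derivative_det, hN, map_neg, map_sum, LinearMap.map_smul_of_tower, sub_eq_add_neg]

theorem detAverage_eq_eval {p : ι → k} (hp : ∑ i, p i = 1) (v : ι → n → k) {x : k} (hx : x ≠ 0)
    (j : ℕ) (B : Matrix n n k) :
    detAverage p v x j B =
      (((algebraMap k (Module.End k k[X]) x + derivative) ^ j : Module.End k k[X])
        (B.map C - (X : k[X]) • (∑ i, p i • vecMulVec (v i) (v i)).map C).det).eval 0 := by
  induction j generalizing B with
  | zero =>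
    rw [detAverage, pow_zero, Module.End.one_apply, ← coe_evalRingHom, RingHom.map_det]
    congr 1
    ext a b
    simp
  | succ j ih =>
    set M := ∑ i, p i • vecMulVec (v i) (v i) with hM
    have pencil : (B.map C - (X : k[X]) • M.map C).map derivative =
        -∑ i, p i • rankOne k[X] (v i) := by
      ext1 a b
      simp [hM, Matrix.sum_apply, rankOne, vecMulVec_apply, smul_eq_C_mul]
    have sample (i : ι) : (B - x⁻¹ • rankOne k (v i)).map C =
        B.map C - x⁻¹ • rankOne k[X] (v i) := by
      ext1 a b
      simp [rankOne, vecMulVec_apply, smul_eq_C_mul]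
    rw [pow_succ, Module.End.mul_apply, LinearMap.add_apply, Module.algebraMap_end_apply,
      ← sum_smul_det_sub_rankOne hp v hx pencil, map_sum, eval_finsetSum, detAverage]
    refine Finset.sum_congr rfl fun i _ => ?_
    rw [map_smul, eval_smul, ih, sample, sub_right_comm, smul_eq_mul, smul_eq_mul, mul_assoc]

theorem gramAverage_nil [Infinite k] {p : ι → k} (hp : ∑ i, p i = 1) (v : ι → n → k) (j : ℕ) :
    gramAverage p v j [] = aeval (derivative : Module.End k k[X])
      (∑ i, p i • vecMulVec (v i) (v i)).charpolyRev (X ^ j) := by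
  refine eq_of_infinite_eval_eq _ _ ((Set.finite_singleton (0 : k)).infinite_compl.mono ?_)
  intro x hx
  rw [Set.mem_ofPred_eq, ← coe_aeval_eq_eval, aeval_gramAverage p v hx, coe_aeval_eq_eval,
    eval_aeval_derivative_X_pow, detAverage_eq_eval hp v hx]
  simp [charpolyRev, Matrix.map_one]

end ExpectedCharpoly

section UpperHalfPlane

variable {ι n : Type*} [Fintype n]

/-- Complex matrices whose quadratic form vanishes only at `0` and has nonnegative imaginary
part. -/
def IsDissipative (B : Matrix n n ℂ) : Prop :=
  ∀ u : n → ℂ, u ≠ 0 → star u ⬝ᵥ B *ᵥ u ≠ 0 ∧ 0 ≤ (star u ⬝ᵥ B *ᵥ u).im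

theorem IsDissipative.add_smul_rankOne {B : Matrix n n ℂ} (hB : IsDissipative B) (v : n → ℝ)
    {t : ℂ} (ht : 0 < t.im) : IsDissipative (B + t • rankOne ℂ v) := by
  intro u hu
  obtain ⟨hne, him⟩ := hB u hu
  set q := star u ⬝ᵥ B *ᵥ u
  set c : ℂ := (algebraMap ℝ ℂ ∘ v) ⬝ᵥ u with hc
  have star_dotProduct : star u ⬝ᵥ (algebraMap ℝ ℂ ∘ v) = star c := by
    simp [hc, dotProduct, mul_comm]
  have form : star u ⬝ᵥ (B + t • rankOne ℂ v) *ᵥ u = q + t * (Complex.normSq c : ℂ) := by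
    rw [add_mulVec, dotProduct_add, smul_mulVec, rankOne, vecMulVec_mulVec, dotProduct_smul,
      dotProduct_smul, star_dotProduct, ← hc, ← Complex.mul_conj, op_smul_eq_smul, smul_eq_mul,
      smul_eq_mul, Complex.star_def]
  rw [form]
  rcases eq_or_ne c 0 with h0 | h0
  · simpa [h0] using And.intro hne him
  · have im_pos : 0 < (q + t * (Complex.normSq c : ℂ)).im := by
      rw [Complex.add_im, Complex.im_mul_ofReal]
      exact add_pos_of_nonneg_of_pos him (mul_pos ht (Complex.normSq_pos.2 h0))
    exact ⟨fun h => im_pos.ne' (by rw [h, Complex.zero_im]), im_pos.le⟩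

variable [DecidableEq n]

open ComplexOrder in
theorem isDissipative_one : IsDissipative (1 : Matrix n n ℂ) := by
  intro u hu
  rw [one_mulVec]
  refine ⟨by rwa [Ne, dotProduct_star_self_eq_zero], le_of_eq ?_⟩
  simp [dotProduct, Complex.mul_im, mul_comm]

theorem IsDissipative.det_ne_zero {B : Matrix n n ℂ} (hB : IsDissipative B) : B.det ≠ 0 := by
  intro h0
  obtain ⟨u, hu, hBu⟩ := exists_mulVec_eq_zero_iff.2 h0
  exact (hB u hu).1 (by rw [hBu, dotProduct_zero])

theorem im_neg_inv_pos {x : ℂ} (hx : 0 < x.im) : 0 < (-x⁻¹).im := by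
  have h0 : x ≠ 0 := by rintro rfl; simp at hx
  rw [Complex.neg_im, Complex.inv_im, neg_div, neg_neg]
  exact div_pos hx (Complex.normSq_pos.2 h0)

theorem isDissipative_one_sub_smul_sum (v : ι → n → ℝ) {x : ℂ} (hx : 0 < x.im) (L : List ι) :
    IsDissipative (1 - x⁻¹ • (L.map fun i => rankOne ℂ (v i)).sum) := by
  induction L with
  | nil => simpa using isDissipative_one
  | cons i L ih =>
    rw [List.map_cons, List.sum_cons, smul_add, ← sub_sub, sub_right_comm, sub_eq_add_neg _ (_ • _),
      ← neg_smul]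
    exact ih.add_smul_rankOne (v i) (im_neg_inv_pos hx)

variable [Fintype ι] {p : ι → ℝ} {v : ι → n → ℝ} {x : ℂ} {j : ℕ}

-- As a function of `t`, `detAverage (B + t • rankOne ℂ u)` is affine, with no zero in the upper
-- half plane.
theorem im_detAverage_div_pos (hx : 0 < x.im)
    (h : ∀ B, IsDissipative B → detAverage p v x j B ≠ 0) {B : Matrix n n ℂ}
    (hB : IsDissipative B) (u : n → ℝ) :
    0 < (x * detAverage p v x j (B - x⁻¹ • rankOne ℂ u) / detAverage p v x j B).im := by
  obtain ⟨κ, hκ⟩ := exists_detAverage_add_smul p v x j B (algebraMap ℝ ℂ ∘ u) (algebraMap ℝ ℂ ∘ u)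
  have hx0 : x ≠ 0 := by rintro rfl; simp at hx
  have h0 := h B hB
  set d := detAverage p v x j B
  have im_slope_nonpos : (κ / d).im ≤ 0 := by
    by_contra! hc
    have hκ0 : κ ≠ 0 := by rintro rfl; simp at hc
    refine h _ (hB.add_smul_rankOne u (im_neg_inv_pos hc)) ((hκ _).trans ?_)
    rw [inv_div, neg_mul, div_mul_cancel₀ _ hκ0, add_neg_cancel]
  have quotient : x * detAverage p v x j (B - x⁻¹ • rankOne ℂ u) / d = x - κ / d := by
    rw [sub_eq_add_neg, ← neg_smul, rankOne, hκ]
    field_simp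
    ring
  rw [quotient, Complex.sub_im]
  linarith

theorem detAverage_ne_zero [Nonempty ι] (hp : ∀ i, 0 < p i) (hx : 0 < x.im) {B : Matrix n n ℂ}
    (hB : IsDissipative B) : detAverage p v x j B ≠ 0 := by
  induction j generalizing B with
  | zero => exact hB.det_ne_zero
  | succ j ih =>
    intro h0
    have im_pos : 0 < (detAverage p v x (j + 1) B / detAverage p v x j B).im := by
      rw [detAverage, Finset.sum_div, Complex.im_sum]
      refine Finset.sum_pos (fun i _ => ?_) Finset.univ_nonempty
      rw [smul_div_assoc, Complex.smul_im]
      exact mul_pos (hp i) (im_detAverage_div_pos hx (fun _ => ih) hB (v i))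
    rw [h0, zero_div, Complex.zero_im] at im_pos
    exact im_pos.false

omit [DecidableEq n] in
theorem im_aeval_gramAverage_div_pos [Nonempty ι] (hp : ∀ i, 0 < p i) (hx : 0 < x.im) (i : ι)
    (L : List ι) :
    0 < (aeval x (gramAverage p v j (i :: L)) / aeval x (gramAverage p v j L)).im := by
  classical
  have h0 : x ≠ 0 := by rintro rfl; simp at hx
  rw [aeval_gramAverage p v h0, aeval_gramAverage p v h0, List.length_cons, pow_succ, mul_assoc,
    mul_div_mul_left _ _ (pow_ne_zero _ h0), List.map_cons, List.sum_cons, smul_add, ← sub_sub,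
    sub_right_comm]
  exact im_detAverage_div_pos hx (fun _ => detAverage_ne_zero hp hx)
    (isDissipative_one_sub_smul_sum v hx L) (v i)

end UpperHalfPlane

section PickQuotient

theorem nonneg_of_hasDerivAt_of_im_nonneg {f : ℂ → ℂ} {d x : ℝ} (hf : HasDerivAt f d x)
    (hx : (f x).im = 0) (him : ∀ z : ℂ, 0 < z.im → 0 ≤ (f z).im) : 0 ≤ d := by
  have vertical : HasDerivAt (fun t : ℝ => (x : ℂ) + t * Complex.I) Complex.I 0 := by
    simpa using (Complex.ofRealCLM.hasDerivAt.mul_const Complex.I).const_add (x : ℂ)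
  have hf' : HasDerivAt f d ((x : ℂ) + (0 : ℝ) * Complex.I) := by simpa using hf
  have im_deriv : HasDerivAt (fun t : ℝ => (f ((x : ℂ) + t * Complex.I)).im) d 0 :=
    (Complex.imCLM.hasFDerivAt.comp_hasDerivAt (0 : ℝ) (hf'.comp (0 : ℝ) vertical)).congr_deriv
      (by simp)
  refine ge_of_tendsto im_deriv.tendsto_slope_zero_right ?_
  filter_upwards [self_mem_nhdsWithin] with t ht
  have im_pos := him (x + t * Complex.I) (by simpa using ht)
  rw [zero_add, Complex.ofReal_zero, zero_mul, add_zero, hx, sub_zero]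
  exact smul_nonneg (inv_nonneg.2 (Set.mem_Ioi.1 ht).le) im_pos

theorem monotoneOn_eval_div {P G : ℝ[X]} {b : ℝ} (hG : ∀ x < b, G.eval x ≠ 0)
    (him : ∀ z : ℂ, 0 < z.im → 0 ≤ (aeval z P / aeval z G).im) :
    MonotoneOn (fun x => P.eval x / G.eval x) (Set.Iio b) := by
  have real_deriv (x : ℝ) (hx : x < b) :=
    (P.hasDerivAt x).div (G.hasDerivAt x) (hG x hx)
  refine monotoneOn_of_hasDerivWithinAt_nonneg (convex_Iio b)
    (fun x hx => (real_deriv x hx).continuousAt.continuousWithinAt)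
    (fun x hx => (real_deriv x (interior_subset (s := Set.Iio b) hx)).hasDerivWithinAt)
    fun x hx => ?_
  rw [interior_Iio] at hx
  have aeval_real (p : ℝ[X]) : aeval (x : ℂ) p = ((p.eval x : ℝ) : ℂ) := by
    simpa using aeval_algebraMap_apply ℂ x p
  have complex_deriv := (P.hasDerivAt_aeval (x : ℂ)).div (G.hasDerivAt_aeval (x : ℂ))
    (by rw [aeval_real]; exact_mod_cast hG x hx)
  refine nonneg_of_hasDerivAt_of_im_nonneg (f := fun z => aeval z P / aeval z G)
    (complex_deriv.congr_deriv ?_) ?_ him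
  · simp only [aeval_real]
    push_cast
    rfl
  · simp only [aeval_real, ← Complex.ofReal_div, Complex.ofReal_im]

/-- The rational function `P / G` is negative on the negative half line and maps the open upper
half plane to the closed one. Negativity also rules out roots of `G` on the negative half line,
where the quotient would have the value `0`. -/
structure IsPickQuotient (P G : ℝ[X]) : Prop where
  eval_div_neg : ∀ x < 0, P.eval x / G.eval x < 0
  im_nonneg : ∀ z : ℂ, 0 < z.im → 0 ≤ (aeval z P / aeval z G).im

namespace IsPickQuotient

theorem sum {ι : Type*} [Fintype ι] [Nonempty ι] {p : ι → ℝ} (hp : ∀ i, 0 < p i) {Q : ι → ℝ[X]}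
    {G : ℝ[X]} (h : ∀ i, IsPickQuotient (Q i) G) : IsPickQuotient (∑ i, p i • Q i) G where
  eval_div_neg x hx := by
    simp only [eval_finsetSum, eval_smul, Finset.sum_div, smul_div_assoc]
    exact Finset.sum_neg (fun i _ => mul_neg_of_pos_of_neg (hp i) ((h i).eval_div_neg x hx))
      Finset.univ_nonempty
  im_nonneg z hz := by
    simp only [map_sum, map_smul, Finset.sum_div, smul_div_assoc, Complex.im_sum, Complex.smul_im]
    exact Finset.sum_nonneg fun i _ => mul_nonneg (hp i).le ((h i).im_nonneg z hz)

variable {P G : ℝ[X]} {b β : ℝ}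

theorem eval_ne_zero_of_neg (h : IsPickQuotient P G) {x : ℝ} (hx : x < 0) : G.eval x ≠ 0 :=
  fun h0 => (h.eval_div_neg x hx).ne (by rw [h0, div_zero])

theorem eval_div_neg_of_lt (h : IsPickQuotient P G) (hP : ∀ x < b, P.eval x ≠ 0)
    (hG : ∀ x < b, G.eval x ≠ 0) {x : ℝ} (hx : x < b) : P.eval x / G.eval x < 0 := by
  by_contra! hge
  have hneg : min x (-1) < 0 := (min_le_right _ _).trans_lt neg_one_lt_zero
  have hcont : ContinuousOn (fun x => P.eval x / G.eval x) (Set.Icc (min x (-1)) x) :=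
    P.continuous.continuousOn.div G.continuous.continuousOn fun y hy => hG y (hy.2.trans_lt hx)
  obtain ⟨y, hy, hy0⟩ := intermediate_value_Icc (min_le_left x (-1)) hcont
    ⟨(h.eval_div_neg _ hneg).le, hge⟩
  have hyb : y < b := hy.2.trans_lt hx
  exact div_ne_zero (hP y hyb) (hG y hyb) hy0

-- The quotient stays in `[P(β - 1) / G(β - 1), 0)` on `(β - 1, β)`.
theorem eval_eq_zero_of_least_root (h : IsPickQuotient P G) (hβ : G.eval β = 0)
    (hP : ∀ x < β, P.eval x ≠ 0) (hG : ∀ x < β, G.eval x ≠ 0) : P.eval β = 0 := by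
  set c := P.eval (β - 1) / G.eval (β - 1)
  have bounded (x : ℝ) (hx : x ∈ Set.Ioo (β - 1) β) : |P.eval x| ≤ |c| * |G.eval x| := by
    rw [← div_le_iff₀ (abs_pos.2 (hG x hx.2)), ← abs_div]
    have lower : c ≤ P.eval x / G.eval x :=
      monotoneOn_eval_div hG h.im_nonneg (sub_one_lt β) hx.2 hx.1.le
    have upper := h.eval_div_neg_of_lt hP hG hx.2
    rw [abs_of_neg upper, abs_of_neg (lower.trans_lt upper)]
    exact neg_le_neg lower
  have limit : |P.eval β| ≤ |c| * |G.eval β| :=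
    le_of_tendsto_of_tendsto (b := nhdsWithin β (Set.Iio β))
      P.continuous.abs.continuousWithinAt (continuous_const.mul G.continuous.abs).continuousWithinAt
      (Filter.eventually_of_mem (Ioo_mem_nhdsLT (sub_one_lt β)) bounded)
  simpa [hβ] using limit

theorem eval_ne_zero (h : IsPickQuotient P G) (hP : ∀ x < b, P.eval x ≠ 0) {x : ℝ} (hx : x < b) :
    G.eval x ≠ 0 := by
  intro hGx
  have hG0 : G ≠ 0 := by
    rintro rfl
    exact h.eval_ne_zero_of_neg neg_one_lt_zero eval_zero
  obtain ⟨β, hβ, hmin⟩ := G.roots.toFinset.exists_min_image id ⟨x, by simpa [hG0] using hGx⟩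
  have root_iff (y : ℝ) : y ∈ G.roots.toFinset ↔ G.eval y = 0 := by simp [hG0]
  have hβb : β < b := (hmin x ((root_iff x).2 hGx)).trans_lt hx
  exact hP β hβb (h.eval_eq_zero_of_least_root ((root_iff β).1 hβ) (fun y hy => hP y (hy.trans hβb))
    fun y hy hy0 => (hmin y ((root_iff y).2 hy0)).not_gt hy)

theorem exists_forall_eval_ne_zero {ι : Type*} [Fintype ι] [Nonempty ι] {p : ι → ℝ}
    (hp : ∀ i, 0 < p i) {Q : ι → ℝ[X]} (h : ∀ i, IsPickQuotient (Q i) G)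
    (hsum : ∀ x < b, (∑ i, p i • Q i).eval x ≠ 0) : ∃ i, ∀ x < b, (Q i).eval x ≠ 0 := by
  by_contra! hroot
  choose r hrb hr using hroot
  have hG (x : ℝ) (hx : x < b) : G.eval x ≠ 0 := (sum hp h).eval_ne_zero hsum hx
  obtain ⟨i₀, -, hmax⟩ := Finset.univ.exists_max_image r Finset.univ_nonempty
  refine ((sum hp h).eval_div_neg_of_lt hsum hG (hrb i₀)).not_ge ?_
  simp only [eval_finsetSum, eval_smul, Finset.sum_div, smul_div_assoc]
  refine Finset.sum_nonneg fun i _ => mul_nonneg (hp i).le ?_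
  have := monotoneOn_eval_div hG (h i).im_nonneg (hrb i) (hrb i₀) (hmax i (Finset.mem_univ i))
  simpa only [hr i, zero_div] using this

end IsPickQuotient

end PickQuotient

section Selection

variable {ι n : Type*} [Fintype ι] [Nonempty ι] [Fintype n] {p : ι → ℝ} {v : ι → n → ℝ} {b : ℝ}

theorem neg_one_pow_mul_eval_charpoly_pos {m : Type*} [Fintype m] [DecidableEq m]
    {A : Matrix m m ℝ} (hA : A.PosSemidef) {x : ℝ} (hx : x < 0) :
    0 < (-1) ^ Fintype.card m * A.charpoly.eval x := by
  have shifted : (-x • (1 : Matrix m m ℝ) + A).PosDef :=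
    (PosDef.one.smul (neg_pos.2 hx)).add_posSemidef hA
  have neg_shifted : Matrix.scalar m x - A = -(-x • (1 : Matrix m m ℝ) + A) := by
    rw [neg_add, neg_smul, neg_neg, smul_one_eq_diagonal, sub_eq_add_neg, scalar_apply]
  rw [eval_charpoly, neg_shifted, det_neg, ← mul_assoc, ← mul_pow, neg_one_mul, neg_neg, one_pow,
    one_mul]
  exact shifted.det_pos

theorem neg_one_pow_mul_eval_gramAverage_pos (hp : ∀ i, 0 < p i) {x : ℝ} (hx : x < 0) (j : ℕ)
    (L : List ι) : 0 < (-1) ^ (j + L.length) * (gramAverage p v j L).eval x := by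
  induction j generalizing L with
  | zero =>
    simpa [gramAverage] using
      neg_one_pow_mul_eval_charpoly_pos (posSemidef_self_mul_conjTranspose (rowsOfList v L)) hx
  | succ j ih =>
    rw [gramAverage, eval_finsetSum, Finset.mul_sum]
    refine Finset.sum_pos (fun i _ => ?_) Finset.univ_nonempty
    rw [eval_smul, smul_eq_mul, mul_left_comm, add_right_comm, add_assoc, ← List.length_cons]
    exact mul_pos (hp i) (ih (i :: L))

theorem isPickQuotient_gramAverage_cons (hp : ∀ i, 0 < p i) (j : ℕ) (L : List ι) (i : ι) :
    IsPickQuotient (gramAverage p v j (i :: L)) (gramAverage p v j L) where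
  eval_div_neg x hx := by
    have quotient_pos := div_pos (neg_one_pow_mul_eval_gramAverage_pos (v := v) hp hx j (i :: L))
      (neg_one_pow_mul_eval_gramAverage_pos (v := v) hp hx j L)
    rw [List.length_cons, ← add_assoc, pow_succ, mul_assoc,
      mul_div_mul_left _ _ (pow_ne_zero _ (by norm_num)), neg_one_mul, neg_div] at quotient_pos
    exact neg_pos.1 quotient_pos
  im_nonneg _ hz := (im_aeval_gramAverage_div_pos hp hz i L).le

theorem exists_list_forall_eval_charpoly_ne_zero (hp : ∀ i, 0 < p i) (j : ℕ) (L : List ι)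
    (h : ∀ x < b, (gramAverage p v j L).eval x ≠ 0) :
    ∃ L' : List ι, L'.length = j + L.length ∧
      ∀ x < b, (rowsOfList v L' * (rowsOfList v L')ᵀ).charpoly.eval x ≠ 0 := by
  induction j generalizing L with
  | zero => exact ⟨L, (zero_add _).symm, h⟩
  | succ j ih =>
    obtain ⟨i, hi⟩ := IsPickQuotient.exists_forall_eval_ne_zero hp
      (isPickQuotient_gramAverage_cons hp j L) h
    obtain ⟨L', hL', h'⟩ := ih (i :: L) hi
    exact ⟨L', by rw [hL', List.length_cons]; ring, h'⟩

end Selection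

section Barrier

variable {ι : Type*}

theorem eval_derivative_prod_X_sub_C {K : Type*} [Field K] (s : Finset ι) (r : ι → K) {x : K}
    (hx : ∀ i ∈ s, x ≠ r i) :
    (derivative (∏ i ∈ s, (X - C (r i)))).eval x =
      -((∏ i ∈ s, (X - C (r i))).eval x * ∑ i ∈ s, (r i - x)⁻¹) := by
  classical
  rw [derivative_prod_finset, eval_finsetSum, Finset.mul_sum, ← Finset.sum_neg_distrib]
  refine Finset.sum_congr rfl fun i hi => ?_
  have hne : r i - x ≠ 0 := sub_ne_zero.2 (hx i hi).symm
  rw [← Finset.mul_prod_erase s _ hi]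
  simp only [derivative_X_sub_C, mul_one, eval_mul, eval_sub, eval_X, eval_C]
  field_simp
  ring

theorem eval_derivative_derivative_prod_X_sub_C {K : Type*} [Field K] (s : Finset ι) (r : ι → K)
    {x : K} (hx : ∀ i ∈ s, x ≠ r i) :
    (derivative (derivative (∏ i ∈ s, (X - C (r i))))).eval x =
      (∏ i ∈ s, (X - C (r i))).eval x *
        ((∑ i ∈ s, (r i - x)⁻¹) ^ 2 - ∑ i ∈ s, (r i - x)⁻¹ ^ 2) := by
  classical
  induction s using Finset.induction_on with
  | empty => simp
  | insert a s ha ih =>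
    have hs (i : ι) (hi : i ∈ s) : x ≠ r i := hx i (Finset.mem_insert_of_mem hi)
    have hne : r a - x ≠ 0 := sub_ne_zero.2 (hx a (Finset.mem_insert_self _ _)).symm
    simp only [Finset.prod_insert ha, Finset.sum_insert ha, derivative_mul, derivative_X_sub_C,
      one_mul, derivative_add, eval_add, eval_mul, eval_sub, eval_X, eval_C,
      eval_derivative_prod_X_sub_C s r hs, ih hs]
    field_simp
    ring

variable [Fintype ι]

/-- The lower barrier function `Φ(x) = ∑ᵢ 1 / (rᵢ - x)` of the polynomial with roots `r`. -/
def barrier {K : Type*} [Field K] (r : ι → K) (x : K) : K :=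
  ∑ i, (r i - x)⁻¹

section Field

variable {K : Type*} [Field K] {r r' : ι → K} {x lam : K}

theorem eval_prod_sub_derivative (hx : ∀ i, x ≠ r i) :
    ((∏ i, (X - C (r i))) - C lam * derivative (∏ i, (X - C (r i)))).eval x =
      (∏ i, (X - C (r i))).eval x * (1 + lam * barrier r x) := by
  rw [eval_sub, eval_mul, eval_C, eval_derivative_prod_X_sub_C _ r fun i _ => hx i, barrier]
  ring

theorem eval_prod_X_sub_C_ne_zero (hx : ∀ i, x ≠ r i) : (∏ i, (X - C (r i))).eval x ≠ 0 := by
  rw [eval_prod]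
  exact Finset.prod_ne_zero_iff.2 fun i _ => by
    rw [eval_sub, eval_X, eval_C]
    exact sub_ne_zero.2 (hx i)

theorem barrier_mul_of_sub_derivative_eq
    (h : (∏ i, (X - C (r i))) - C lam * derivative (∏ i, (X - C (r i))) = ∏ i, (X - C (r' i)))
    (hx : ∀ i, x ≠ r i) (hx' : ∀ i, x ≠ r' i) :
    barrier r' x * (1 + lam * barrier r x) =
      barrier r x + lam * (barrier r x ^ 2 - ∑ i, (r i - x)⁻¹ ^ 2) := by
  have log_derivative := eval_derivative_prod_X_sub_C Finset.univ r' fun i _ => hx' i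
  rw [← h, eval_prod_sub_derivative hx, derivative_sub, derivative_C_mul, eval_sub, eval_mul,
    eval_C, eval_derivative_prod_X_sub_C _ r fun i _ => hx i,
    eval_derivative_derivative_prod_X_sub_C _ r fun i _ => hx i] at log_derivative
  refine mul_left_cancel₀ (eval_prod_X_sub_C_ne_zero hx) ?_
  simp only [barrier] at log_derivative ⊢
  linear_combination log_derivative

end Field

section RealRooted

theorem im_barrier_pos [Nonempty ι] (r : ι → ℝ) {z : ℂ} (hz : 0 < z.im) :
    0 < (barrier (fun i => (r i : ℂ)) z).im := by
  rw [barrier, Complex.im_sum]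
  refine Finset.sum_pos (fun i _ => ?_) Finset.univ_nonempty
  have im_neg : ((r i : ℂ) - z).im < 0 := by simpa using hz
  have hne : (r i : ℂ) - z ≠ 0 := fun h => im_neg.ne (by rw [h, Complex.zero_im])
  rw [Complex.inv_im]
  exact div_pos (neg_pos.2 im_neg) (Complex.normSq_pos.2 hne)

theorem aeval_prod_sub_derivative_ne_zero (r : ι → ℝ) (lam : ℝ) {z : ℂ} (hz : 0 < z.im) :
    aeval z ((∏ i, (X - C (r i))) - C lam * derivative (∏ i, (X - C (r i)))) ≠ 0 := by
  have hzr (i : ι) : z ≠ (r i : ℂ) := by rintro rfl; simp at hz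
  have complexified : ((∏ i, (X - C (r i))) - C lam * derivative (∏ i, (X - C (r i)))).map
      (algebraMap ℝ ℂ) = (∏ i, (X - C (r i : ℂ))) -
        C (lam : ℂ) * derivative (∏ i, (X - C (r i : ℂ))) := by
    simp [← derivative_map, Polynomial.map_prod]
  rw [← eval_map_algebraMap, complexified, eval_prod_sub_derivative hzr]
  refine mul_ne_zero (eval_prod_X_sub_C_ne_zero hzr) fun h => ?_
  have im_zero : lam * (barrier (fun i => (r i : ℂ)) z).im = 0 := by
    simpa using congrArg Complex.im h
  rcases isEmpty_or_nonempty ι with hι | hι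
  · simp [barrier] at h
  · rw [(mul_eq_zero.1 im_zero).resolve_right (im_barrier_pos r hz).ne'] at h
    simp at h

theorem splits_of_aeval_ne_zero {p : ℝ[X]} (h : ∀ z : ℂ, 0 < z.im → aeval z p ≠ 0) :
    p.Splits := by
  refine (IsAlgClosed.splits (p.map (algebraMap ℝ ℂ))).of_splits_map (algebraMap ℝ ℂ) ?_
  intro z hz
  have hz0 : aeval z p = 0 := by
    rw [← eval_map_algebraMap]
    exact (mem_roots'.1 hz).2
  rcases lt_trichotomy z.im 0 with hlt | heq | hgt
  · refine absurd ?_ (h (starRingEnd ℂ z) (by simpa using hlt))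
    rw [aeval_conj, hz0, map_zero]
  · exact ⟨z.re, Complex.ext rfl heq.symm⟩
  · exact absurd hz0 (h z hgt)

theorem exists_eq_prod_X_sub_C {K : Type*} [Field K] {p : K[X]} (hp : p.Monic) (hs : p.Splits)
    {k : ℕ} (hk : p.natDegree = k) : ∃ r : Fin k → K, p = ∏ i, (X - C (r i)) := by
  obtain ⟨l, hl⟩ := Quot.exists_rep p.roots
  have hroots : p.roots = (l : Multiset K) := hl.symm
  have hlen : l.length = k := by rw [← hk, hs.natDegree_eq_card_roots, hroots, Multiset.coe_card]
  subst hlen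
  refine ⟨fun i => l[i], ?_⟩
  rw [hs.eq_prod_roots_of_monic hp, hroots, Multiset.map_coe, Multiset.prod_coe]
  exact (Fin.prod_univ_fun_getElem l fun a => X - C a).symm

theorem exists_prod_X_sub_C_sub_derivative {k : ℕ} (r : Fin k → ℝ) (lam : ℝ) :
    ∃ r' : Fin k → ℝ, (∏ i, (X - C (r i))) - C lam * derivative (∏ i, (X - C (r i))) =
      ∏ i, (X - C (r' i)) := by
  have monic : (∏ i, (X - C (r i))).Monic := monic_prod_of_monic _ _ fun i _ => monic_X_sub_C _
  have degree_lt : (C lam * derivative (∏ i, (X - C (r i)))).degree <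
      (∏ i, (X - C (r i))).degree := by
    rw [← smul_eq_C_mul]
    exact (degree_smul_le lam _).trans_lt (degree_derivative_lt monic.ne_zero)
  refine exists_eq_prod_X_sub_C (monic.sub_of_left degree_lt)
    (splits_of_aeval_ne_zero fun z hz => aeval_prod_sub_derivative_ne_zero r lam hz) ?_
  rw [natDegree_eq_of_degree_eq (degree_sub_eq_left_of_degree_lt degree_lt)]
  simp

end RealRooted

section Shift

variable {r : ι → ℝ} {b δ lam α : ℝ}

theorem barrier_nonneg (hb : ∀ i, b < r i) : 0 ≤ barrier r b :=
  Finset.sum_nonneg fun i _ => inv_nonneg.2 (sub_nonneg.2 (hb i).le)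

theorem add_inv_le_of_barrier_le (hb : ∀ i, b < r i) (hα : barrier r b ≤ α) (i : ι) :
    b + α⁻¹ ≤ r i := by
  have single : (r i - b)⁻¹ ≤ α :=
    (Finset.single_le_sum (f := fun i => (r i - b)⁻¹)
      (fun j _ => inv_nonneg.2 (sub_nonneg.2 (hb j).le)) (Finset.mem_univ i)).trans hα
  have := inv_le_of_inv_le₀ (sub_pos.2 (hb i)) single
  linarith

theorem barrier_add_le (hδ : 0 ≤ δ) (hlam : 0 ≤ lam) (hr : ∀ i, b + δ < r i)
    (hδb : δ * (1 + lam * barrier r b) ≤ lam) :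
    barrier r (b + δ) + lam * (barrier r (b + δ) ^ 2 - ∑ i, (r i - (b + δ))⁻¹ ^ 2) ≤
      barrier r b * (1 + lam * barrier r (b + δ)) := by
  have hx (i : ι) : 0 < r i - (b + δ) := sub_pos.2 (hr i)
  have hb (i : ι) : 0 < r i - b := by linarith [hx i]
  have inv_sub_inv (i : ι) :
      (r i - (b + δ))⁻¹ - (r i - b)⁻¹ = δ * ((r i - (b + δ))⁻¹ * (r i - b)⁻¹) := by
    rw [inv_sub_inv' (hx i).ne' (hb i).ne']
    ring
  set S := ∑ i, (r i - (b + δ))⁻¹ * (r i - b)⁻¹ with hS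
  set R := ∑ i, (r i - (b + δ))⁻¹ ^ 2 * (r i - b)⁻¹ with hR
  have increment : barrier r (b + δ) - barrier r b = δ * S := by
    simp only [barrier, hS, ← Finset.sum_sub_distrib, Finset.mul_sum, inv_sub_inv]
  have second_increment : ∑ i, (r i - (b + δ))⁻¹ ^ 2 - S = δ * R := by
    simp only [hS, hR, ← Finset.sum_sub_distrib, Finset.mul_sum]
    exact Finset.sum_congr rfl fun i _ => by
      linear_combination (r i - (b + δ))⁻¹ * inv_sub_inv i
  have cauchy_schwarz : S ^ 2 ≤ R * barrier r b :=
    Finset.sum_sq_le_sum_mul_sum_of_sq_le_mul _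
      (fun i _ => mul_nonneg (sq_nonneg _) (inv_pos.2 (hb i)).le)
      (fun i _ => (inv_pos.2 (hb i)).le) fun i _ => by ring_nf; rfl
  have hS0 : 0 ≤ S :=
    Finset.sum_nonneg fun i _ => mul_nonneg (inv_pos.2 (hx i)).le (inv_pos.2 (hb i)).le
  have hR0 : 0 ≤ R :=
    Finset.sum_nonneg fun i _ => mul_nonneg (sq_nonneg _) (inv_pos.2 (hb i)).le
  suffices δ * S * (1 + lam * (barrier r b + δ * S)) ≤ lam * (S + δ * R) by
    rw [← increment, ← second_increment] at this
    linarith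
  calc δ * S * (1 + lam * (barrier r b + δ * S))
      = δ * (1 + lam * barrier r b) * S + lam * δ ^ 2 * S ^ 2 := by ring
    _ ≤ δ * (1 + lam * barrier r b) * S + lam * δ ^ 2 * (R * barrier r b) := by gcongr
    _ = δ * (1 + lam * barrier r b) * (S + δ * R) - δ ^ 2 * R := by ring
    _ ≤ δ * (1 + lam * barrier r b) * (S + δ * R) := sub_le_self _ (by positivity)
    _ ≤ lam * (S + δ * R) := by gcongr

theorem lt_of_sub_derivative_eq {r' : ι → ℝ} (hlam : 0 ≤ lam) (hr : ∀ i, b < r i)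
    (h : (∏ i, (X - C (r i))) - C lam * derivative (∏ i, (X - C (r i))) = ∏ i, (X - C (r' i)))
    (i : ι) : b < r' i := by
  by_contra! hle
  have below (j : ι) : r' i < r j := hle.trans_lt (hr j)
  have eval_eq := eval_prod_sub_derivative (lam := lam) fun j => (below j).ne
  rw [h, eval_prod, Finset.prod_eq_zero (Finset.mem_univ i) (by simp)] at eval_eq
  refine mul_ne_zero (eval_prod_X_sub_C_ne_zero fun j => (below j).ne) ?_ eval_eq.symm
  exact (add_pos_of_pos_of_nonneg one_pos (mul_nonneg hlam (barrier_nonneg below))).ne'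

end Shift

/-- `p` is a product of `k` real linear factors whose roots lie above `b`, and its lower barrier
function at `b` is at most `α`. -/
def HasLowerBarrier (p : ℝ[X]) (k : ℕ) (b α : ℝ) : Prop :=
  ∃ r : Fin k → ℝ, p = ∏ i, (X - C (r i)) ∧ (∀ i, b < r i) ∧ barrier r b ≤ α

namespace HasLowerBarrier

variable {p : ℝ[X]} {k : ℕ} {b α lam : ℝ}

theorem eval_ne_zero (h : HasLowerBarrier p k b α) {x : ℝ} (hx : x < b + α⁻¹) : p.eval x ≠ 0 := by
  obtain ⟨r, rfl, hb, hsum⟩ := h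
  exact eval_prod_X_sub_C_ne_zero fun i => (hx.trans_le (add_inv_le_of_barrier_le hb hsum i)).ne

theorem sub_derivative (h : HasLowerBarrier p k b α) (hα : 0 < α) (hlam : 0 ≤ lam) :
    HasLowerBarrier (p - C lam * derivative p) k (b + lam / (1 + lam * α)) α := by
  obtain ⟨r, rfl, hb, hbα⟩ := h
  obtain ⟨r', hr'⟩ := exists_prod_X_sub_C_sub_derivative r lam
  have hden : 0 < 1 + lam * α := by positivity
  set δ := lam / (1 + lam * α) with hδ
  have hδα : δ < α⁻¹ := by
    rw [hδ, div_lt_iff₀ hden, mul_add, mul_one, mul_comm lam, inv_mul_cancel_left₀ hα.ne']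
    exact lt_add_of_pos_left _ (inv_pos.2 hα)
  have above (i : Fin k) : b + δ < r i :=
    (add_lt_add_right hδα b).trans_le (add_inv_le_of_barrier_le hb hbα i)
  have above' := lt_of_sub_derivative_eq hlam above hr'
  have shift_le : δ * (1 + lam * barrier r b) ≤ lam := by
    rw [hδ, div_mul_eq_mul_div, div_le_iff₀ hden]
    gcongr
  refine ⟨r', hr', above', le_trans ?_ hbα⟩
  refine le_of_mul_le_mul_right (a := 1 + lam * barrier r (b + δ)) ?_
    (add_pos_of_pos_of_nonneg one_pos (mul_nonneg hlam (barrier_nonneg above)))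
  rw [barrier_mul_of_sub_derivative_eq hr' (fun i => (above i).ne) fun i => (above' i).ne]
  exact barrier_add_le (by positivity) hlam above shift_le

end HasLowerBarrier

theorem hasLowerBarrier_aeval_derivative_prod {σ : Type*} (s : Finset σ) {lam : σ → ℝ}
    (hlam : ∀ a ∈ s, 0 ≤ lam a) (k : ℕ) {α : ℝ} (hα : 0 < α) :
    HasLowerBarrier
      (aeval (derivative : Module.End ℝ ℝ[X]) (∏ a ∈ s, (1 - C (lam a) * X)) (X ^ k)) k
      (-(k / α) + ∑ a ∈ s, lam a / (1 + lam a * α)) α := by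
  classical
  induction s using Finset.induction_on with
  | empty =>
    refine ⟨0, by simp, fun i => ?_, ?_⟩
    · have : 0 < k := i.pos
      simp only [Finset.sum_empty, add_zero, Pi.zero_apply, Left.neg_neg_iff]
      positivity
    · rcases eq_or_ne k 0 with rfl | hk
      · simpa [barrier] using hα.le
      · simpa [barrier] using (mul_div_cancel₀ α (Nat.cast_ne_zero.2 hk)).le
  | insert a s ha ih =>
    have := (ih fun b hb => hlam b (Finset.mem_insert_of_mem hb)).sub_derivative hα
      (hlam a (Finset.mem_insert_self a s))
    rw [Finset.sum_insert ha, Finset.prod_insert ha, add_comm (lam a / _), ← add_assoc]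
    simpa [smul_eq_C_mul] using this

end Barrier

section LeastRoot

variable {σ : Type*} [Fintype σ] {lam : σ → ℝ} {ε α : ℝ}

-- The tangent line of the concave function `t ↦ t / (1 + α t)` at `1 + α t = ε⁻¹`.
theorem tangent_le_div {t : ℝ} (ht : 0 ≤ t) (hα : 0 ≤ α) :
    t * (2 * ε - ε ^ 2) - ε ^ 2 * α * t ^ 2 ≤ t / (1 + t * α) := by
  rw [le_div_iff₀ (by positivity)]
  have := mul_nonneg ht (sq_nonneg (1 - ε * (1 + t * α)))
  linarith

theorem eval_aeval_derivative_prod_ne_zero (hlam : ∀ a, 0 ≤ lam a) (hpos : 0 < ∑ a, lam a)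
    (hε0 : 0 < ε) (hε1 : ε < 1) {k : ℕ}
    (hk : (k : ℝ) ≤ (1 - ε) ^ 2 * ((∑ a, lam a) ^ 2 / ∑ a, lam a ^ 2)) {x : ℝ}
    (hx : x < ε ^ 2 * ∑ a, lam a) :
    (aeval (derivative : Module.End ℝ ℝ[X]) (∏ a, (1 - C (lam a) * X)) (X ^ (k + 1))).eval x ≠
      0 := by
  set T := ∑ a, lam a
  set Q := ∑ a, lam a ^ 2
  have hQ : 0 < Q := by
    obtain ⟨a, ha, hne⟩ := Finset.exists_ne_zero_of_sum_ne_zero hpos.ne'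
    exact Finset.sum_pos' (fun a _ => sq_nonneg _) ⟨a, ha, pow_pos ((hlam a).lt_of_ne' hne) 2⟩
  have hε : 0 < 1 - ε := sub_pos.2 hε1
  -- This level maximizes the resulting bound on the least root.
  set α := (1 - ε) / ε * (T / Q) with hα_def
  have hα : 0 < α := by positivity
  refine (hasLowerBarrier_aeval_derivative_prod Finset.univ (fun a _ => hlam a) (k + 1)
    hα).eval_ne_zero (hx.trans_le ?_)
  have shift_sum : ε * T ≤ ∑ a, lam a / (1 + lam a * α) := by
    refine le_trans (le_of_eq ?_)
      (Finset.sum_le_sum fun a _ => tangent_le_div (ε := ε) (hlam a) hα.le)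
    rw [Finset.sum_sub_distrib, ← Finset.sum_mul, ← Finset.mul_sum]
    change ε * T = T * (2 * ε - ε ^ 2) - ε ^ 2 * α * Q
    rw [hα_def]
    field_simp
    ring
  have start : k / α ≤ ε * (1 - ε) * T := by
    rw [div_le_iff₀ hα]
    refine hk.trans (le_of_eq ?_)
    rw [hα_def]
    field_simp
  rw [Nat.cast_succ, add_div, one_div]
  linarith

end LeastRoot

section LeastSingularValue

theorem posSemidef_sub_smul_one {κ : Type*} [Fintype κ] [DecidableEq κ] {M : Matrix κ κ ℝ}
    (hM : M.IsHermitian) {b : ℝ} (h : ∀ x < b, M.charpoly.eval x ≠ 0) :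
    (M - b • (1 : Matrix κ κ ℝ)).PosSemidef := by
  refine posSemidef_iff_isHermitian_and_spectrum_nonneg.2
    ⟨hM.sub (isHermitian_one.smul (IsSelfAdjoint.all b)), fun y hy => ?_⟩
  rw [← Algebra.algebraMap_eq_smul_one, ← spectrum.sub_singleton_eq, Set.sub_singleton] at hy
  obtain ⟨x, hx, rfl⟩ := hy
  have root : M.charpoly.eval x = 0 := mem_spectrum_iff_isRoot_charpoly.1 hx
  exact sub_nonneg.2 (not_lt.1 fun hlt => h x hlt root)

variable {ι κ : Type*} [Fintype ι] [Fintype κ] [DecidableEq κ] {B : Matrix ι κ ℝ} {b c : ℝ}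

theorem norm_toEuclideanLin_sq (B : Matrix ι κ ℝ) (x : EuclideanSpace ℝ κ) :
    ‖toEuclideanLin B x‖ ^ 2 = x.ofLp ⬝ᵥ ((Bᵀ * B) *ᵥ x.ofLp) := by
  rw [EuclideanSpace.real_norm_sq_eq, ← mulVec_mulVec, dotProduct_mulVec, vecMul_transpose]
  exact Finset.sum_congr rfl fun i _ => sq _

theorem le_sigmaMin [Nonempty κ] (h : ∀ x < b ^ 2, (Bᵀ * B).charpoly.eval x ≠ 0) :
    b ≤ sigmaMin B := by
  refine le_csInf ((NormedSpace.sphere_nonempty.2 zero_le_one).image _) ?_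
  rintro _ ⟨x, hx, rfl⟩
  have unit : x.ofLp ⬝ᵥ x.ofLp = 1 := by
    have := EuclideanSpace.real_norm_sq_eq x
    rw [mem_sphere_zero_iff_norm.1 hx, one_pow] at this
    rw [this, dotProduct]
    exact Finset.sum_congr rfl fun i _ => (sq _).symm
  have nonneg := (posSemidef_sub_smul_one (isHermitian_conjTranspose_mul_self B)
    h).dotProduct_mulVec_nonneg x.ofLp
  rw [star_trivial, sub_mulVec, smul_mulVec, one_mulVec, dotProduct_sub, dotProduct_smul, unit,
    smul_eq_mul, mul_one, conjTranspose_eq_transpose_of_trivial, ← norm_toEuclideanLin_sq,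
    sub_nonneg] at nonneg
  exact le_of_sq_le_sq nonneg (norm_nonneg _)

theorem sigmaMin_smul (hc : 0 ≤ c) (B : Matrix ι κ ℝ) : sigmaMin (c • B) = c * sigmaMin B := by
  simp only [sigmaMin, sInf_image', Real.mul_iInf_of_nonneg hc, map_smul, LinearMap.smul_apply,
    norm_smul, Real.norm_of_nonneg hc]

end LeastSingularValue

section RestrictedInvertibility

theorem nodup_of_det_ne_zero {ι n k : Type*} [Fintype n] [Field k] {v : ι → n → k} {L : List ι}
    (h : (rowsOfList v L * (rowsOfList v L)ᵀ).det ≠ 0) : L.Nodup := by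
  refine List.nodup_iff_injective_get.2 fun s t hst => ?_
  by_contra hne
  refine h (det_zero_of_row_eq hne ?_)
  ext a
  simp only [mul_apply, rowsOfList, of_apply, hst]

variable {ι n : Type*} [Fintype ι] [Fintype n] {p : ι → ℝ} {v : ι → n → ℝ}

theorem exists_finset_forall_eval_charpoly_ne_zero [DecidableEq ι] [Nonempty ι]
    (hp : ∀ i, 0 < p i) {b : ℝ} (hb : 0 < b) (k : ℕ)
    (h : ∀ x < b, (gramAverage p v k []).eval x ≠ 0) :
    ∃ S : Finset ι, S.card = k ∧
      ∀ x < b, ((of fun i : S => v i) * (of fun i : S => v i)ᵀ).charpoly.eval x ≠ 0 := by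
  obtain ⟨L, hlen, hL⟩ := exists_list_forall_eval_charpoly_ne_zero hp k [] h
  have nodup : L.Nodup := nodup_of_det_ne_zero (v := v) <| by
    rw [det_eq_sign_charpoly_coeff, coeff_zero_eq_eval_zero]
    exact mul_ne_zero (pow_ne_zero _ (neg_ne_zero.2 one_ne_zero)) (hL 0 hb)
  refine ⟨L.toFinset, by rw [List.toFinset_card_of_nodup nodup, hlen, List.length_nil, add_zero],
    fun x hx => ?_⟩
  let e : Fin L.length ≃ L.toFinset :=
    (nodup.getEquiv L).trans (Equiv.subtypeEquivRight fun i => List.mem_toFinset.symm)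
  have reindexed : (of fun i : L.toFinset => v i) * (of fun i : L.toFinset => v i)ᵀ =
      reindex e e (rowsOfList v L * (rowsOfList v L)ᵀ) := by
    ext i j
    simp [e, rowsOfList, mul_apply]
  rw [reindexed, charpoly_reindex]
  exact hL x hx

theorem exists_finset_le_sigmaMin [DecidableEq ι] [DecidableEq n] [Nonempty ι] {σ : Type*}
    [Fintype σ] (hp : ∀ i, 0 < p i) {lam : σ → ℝ} (hlam : ∀ a, 0 ≤ lam a) (hpos : 0 < ∑ a, lam a)
    (hchar : (∑ i, p i • vecMulVec (v i) (v i)).charpolyRev = ∏ a, (1 - C (lam a) * X))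
    {ε : ℝ} (hε0 : 0 < ε) (hε1 : ε < 1) {k : ℕ}
    (hk : (k : ℝ) ≤ (1 - ε) ^ 2 * ((∑ a, lam a) ^ 2 / ∑ a, lam a ^ 2)) :
    ∃ S : Finset ι, S.card = k + 1 ∧
      ε * (√(∑ a, lam a) / √(∑ i, p i)) ≤ sigmaMin (of fun i : S => v i)ᵀ := by
  set s := ∑ i, p i
  have hs : 0 < s := Finset.sum_pos (fun i _ => hp i) Finset.univ_nonempty
  have normalized : ∑ i, p i / s = 1 := by rw [← Finset.sum_div, div_self hs.ne']
  have average : ∑ i, (p i / s) • vecMulVec (√s • v i) (√s • v i) =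
      ∑ i, p i • vecMulVec (v i) (v i) := by
    refine Finset.sum_congr rfl fun i _ => ?_
    rw [smul_vecMulVec, vecMulVec_smul, smul_smul, smul_smul, mul_assoc,
      Real.mul_self_sqrt hs.le, div_mul_cancel₀ _ hs.ne']
  have roots (x : ℝ) (hx : x < ε ^ 2 * ∑ a, lam a) :
      (gramAverage (fun i => p i / s) (fun i => √s • v i) (k + 1) []).eval x ≠ 0 := by
    rw [gramAverage_nil normalized, average, hchar]
    exact eval_aeval_derivative_prod_ne_zero hlam hpos hε0 hε1 hk hx
  obtain ⟨S, hS, hroots⟩ := exists_finset_forall_eval_charpoly_ne_zero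
    (fun i => div_pos (hp i) hs) (by positivity) (k + 1) roots
  have : Nonempty S := Finset.card_pos.1 (hS ▸ k.succ_pos) |>.to_subtype
  refine ⟨S, hS, ?_⟩
  rw [← mul_div_assoc, div_le_iff₀' (Real.sqrt_pos.2 hs), ← sigmaMin_smul (Real.sqrt_nonneg s)]
  refine le_sigmaMin fun x hx => ?_
  rw [mul_pow, Real.sq_sqrt hpos.le] at hx
  exact hroots x hx

end RestrictedInvertibility

section SingularValues

theorem charpolyRev_mul_comm {m n R : Type*} [Fintype m] [DecidableEq m] [Fintype n]
    [DecidableEq n] [CommRing R] (A : Matrix m n R) (B : Matrix n m R) :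
    (A * B).charpolyRev = (B * A).charpolyRev := by
  rw [charpolyRev, charpolyRev, Matrix.map_mul, Matrix.map_mul, ← smul_mul, det_one_sub_mul_comm,
    Matrix.mul_smul]

-- Both sides come from the diagonal matrix with entries `r`.
theorem reverse_prod_X_sub_C {ι R : Type*} [Fintype ι] [CommRing R] (r : ι → R) :
    (∏ i, (X - C (r i))).reverse = ∏ i, (1 - C (r i) * X) := by
  classical
  rw [← charpoly_diagonal, reverse_charpoly, charpolyRev, diagonal_map C_0, ← diagonal_smul,
    ← diagonal_one, diagonal_sub, det_diagonal]
  simp only [Pi.smul_apply, smul_eq_mul, X_mul_C]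

theorem trace_transpose_mul_self_eq_norm_sq {ι κ : Type*} [Fintype ι] [Fintype κ]
    (A : Matrix ι κ ℝ) : (Aᵀ * A).trace = ‖A‖ ^ 2 := by
  rw [frobenius_norm_def, ← Real.sqrt_eq_rpow, Real.sq_sqrt (by positivity), Finset.sum_comm]
  simp [trace, mul_apply, sq]

variable {m n : ℕ} (A : Matrix (Fin n) (Fin m) ℝ)

theorem charpoly_transpose_mul_self :
    (Aᵀ * A).charpoly =
      ∏ i : Fin m, (X - C ((toEuclideanLin A).singularValues i ^ 2)) := by
  set T := toEuclideanLin A with hT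
  have hm : Module.finrank ℝ (EuclideanSpace ℝ (Fin m)) = m := finrank_euclideanSpace_fin
  have gram : (LinearMap.adjoint T ∘ₗ T).charpoly = (Aᵀ * A).charpoly := by
    rw [hT, ← toEuclideanLin_conjTranspose_eq_adjoint, conjTranspose_eq_transpose_of_trivial,
      ← toLpLin_mul, toLpLin_eq_toLin, charpoly_toLin]
  rw [← gram, T.isSymmetric_adjoint_comp_self.charpoly_eq hm]
  exact Finset.prod_congr rfl fun i _ => by rw [T.sq_singularValues_fin hm]; rfl

theorem charpolyRev_mul_transpose_self :
    (A * Aᵀ).charpolyRev =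
      ∏ i : Fin m, (1 - C ((toEuclideanLin A).singularValues i ^ 2) * X) := by
  rw [charpolyRev_mul_comm, ← reverse_charpoly, charpoly_transpose_mul_self, reverse_prod_X_sub_C]

theorem sum_sq_singularValues :
    ∑ i : Fin m, (toEuclideanLin A).singularValues i ^ 2 = ‖A‖ ^ 2 := by
  rw [← trace_transpose_mul_self_eq_norm_sq, trace_eq_neg_charpoly_nextCoeff,
    charpoly_transpose_mul_self, ← charpoly_diagonal, ← trace_eq_neg_charpoly_nextCoeff,
    trace_diagonal]

theorem sum_singularValues_pow {k : ℕ} (hk : k ≠ 0) :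
    ((toEuclideanLin A).singularValues.sum fun _ s => s ^ k) =
      ∑ i : Fin m, (toEuclideanLin A).singularValues i ^ k := by
  rw [Finsupp.sum_of_support_subset _ (s := Finset.range m) (fun i hi => ?_) _
    (fun _ _ => zero_pow hk), Finset.sum_range]
  by_contra hle
  refine Finsupp.mem_support_iff.1 hi (LinearMap.singularValues_of_finrank_le _ ?_)
  rwa [finrank_euclideanSpace_fin, ← not_lt, ← Finset.mem_range]

theorem srank4_eq :
    srank4 A = (∑ i : Fin m, (toEuclideanLin A).singularValues i ^ 2) ^ 2 /
      ∑ i : Fin m, ((toEuclideanLin A).singularValues i ^ 2) ^ 2 := by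
  simp only [srank4, sum_singularValues_pow A two_ne_zero, sum_singularValues_pow A four_ne_zero,
    ← pow_mul]

end SingularValues

section WeightedColumns

theorem sum_inv_sq_smul_vecMulVec {ι κ K : Type*} [Fintype κ] [Field K] (A : Matrix ι κ K)
    {w : κ → K} (hw : ∀ i, w i ≠ 0) :
    ∑ i, (w i)⁻¹ ^ 2 • vecMulVec (w i • Aᵀ i) (w i • Aᵀ i) = A * Aᵀ := by
  ext a b
  rw [Matrix.sum_apply, mul_apply]
  refine Finset.sum_congr rfl fun i _ => ?_
  have := hw i
  simp only [Matrix.smul_apply, vecMulVec_apply, Pi.smul_apply, transpose_apply, smul_eq_mul]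
  field_simp

theorem norm_inv_of_isDiag {κ : Type*} [Fintype κ] [DecidableEq κ] {W : Matrix κ κ ℝ}
    (hW : W.IsDiag) (hW0 : ∀ i, W i i ≠ 0) : ‖W⁻¹‖ = √(∑ i, (W i i)⁻¹ ^ 2) := by
  have inverse : W⁻¹ = diagonal fun i => (W i i)⁻¹ := by
    refine inv_eq_left_inv ?_
    nth_rewrite 2 [← hW.diagonal_diag]
    rw [diagonal_mul_diagonal, ← diagonal_one]
    exact congrArg diagonal (funext fun i => inv_mul_cancel₀ (hW0 i))
  rw [inverse, frobenius_norm_diagonal, EuclideanSpace.norm_eq]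
  simp

theorem colSubmatrix_mul_principalSubmatrix {m n : ℕ} (A : Matrix (Fin n) (Fin m) ℝ)
    {W : Matrix (Fin m) (Fin m) ℝ} (hW : W.IsDiag) (S : Finset (Fin m)) :
    colSubmatrix A S * principalSubmatrix W S = (of fun i : S => W i i • Aᵀ i)ᵀ := by
  have diagonal_sub : principalSubmatrix W S = diagonal fun i : S => W i i :=
    (hW.submatrix Subtype.val_injective).diagonal_diag.symm
  ext a i
  rw [diagonal_sub, mul_diagonal, mul_comm]
  rfl

end WeightedColumns

theorem theorem1p3 {n m : ℕ} (A : Matrix (Fin n) (Fin m) ℝ) (hA : A ≠ 0)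
    (ε : ℝ) (hε0 : 0 < ε) (hε1 : ε < 1)
    (W : Matrix (Fin m) (Fin m) ℝ) (hWdiag : W.IsDiag) (hW : ∀ i, W i i ≠ 0) :
    ∃ S : Finset (Fin m),
      S.card = ⌊(1 - ε) ^ 2 * srank4 A⌋₊ + 1 ∧
      ε * (‖A‖ / ‖W⁻¹‖) ≤ sigmaMin (colSubmatrix A S * principalSubmatrix W S) := by
  obtain ⟨_, i, _⟩ : ∃ a i, A a i ≠ 0 := by
    by_contra! h
    exact hA (Matrix.ext h)
  have : Nonempty (Fin m) := ⟨i⟩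
  have average := congrArg charpolyRev (sum_inv_sq_smul_vecMulVec A hW)
  rw [charpolyRev_mul_transpose_self] at average
  have floor_le : (⌊(1 - ε) ^ 2 * srank4 A⌋₊ : ℝ) ≤ (1 - ε) ^ 2 * srank4 A :=
    Nat.floor_le (by rw [srank4_eq]; positivity)
  nth_rewrite 2 [srank4_eq] at floor_le
  obtain ⟨S, hcard, hS⟩ := exists_finset_le_sigmaMin
    (fun i => sq_pos_of_ne_zero (inv_ne_zero (hW i))) (fun i => sq_nonneg _)
    (by rw [sum_sq_singularValues]; exact pow_pos (norm_pos_iff.2 hA) 2) average hε0 hε1 floor_le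
  refine ⟨S, hcard, ?_⟩
  rwa [sum_sq_singularValues, Real.sqrt_sq (norm_nonneg A), ← norm_inv_of_isDiag hWdiag hW,
    ← colSubmatrix_mul_principalSubmatrix A hWdiag] at hS
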